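/- Let $(\Omega,\mathcal A,\mu)$ be a probability space, let $T:\Omega\to\Omega$ be an invertible, bi-measurable, ergodic measure-preserving transformation, and let $(\mathcal F_i)_{i\in\mathbb Z}$ be a filtration of sub-$\sigma$-algebras of $\mathcal A$ with $\mathcal F_{i+1}=T^{-1}\mathcal F_i$ for all $i\in\mathbb Z$. Let $f\in L^2(\mu)$ be $\mathcal F_0$-measurable with $E(f\circ T\mid\mathcal F_0)=0$ $\mu$-a.e. (that is, $f$ belongs to the martingale difference space $\mathcal M$). Put $X_i=f\circ T^i$ and $S_n(f)=X_1+\cdots+X_n$, and let $\mu(\omega;\cdot)=\mu_\omega$ be a regular conditional probability on $\mathcal B=\sigma\{X_1,X_2,\dots\}$ given $\mathcal F_0$: $\mu_\omega$ is a probability measure on $\mathcal B$ for every $\omega\in\Omega$, and for every $B\in\mathcal B$ the function $\omega\mapsto\mu_\omega(B)$ is a version of $\mu(B\mid\mathcal F_0)$. Let $G_n(\omega;z)=\mu_\omega\{S_n(f)/\sqrt n\le z\}$ for $z\in\mathbb R$. Then for $\mu$-a.e. $\omega$ the distribution functions $G_n(\omega;\cdot)$ converge weakly, as $n\to\infty$,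 to the distribution function of the normal distribution with mean $0$ and variance $\|f\|_2^2=\int_\Omega f^2\,d\mu$ (the point mass at $0$ if $\|f\|_2=0$); that is, $G_n(\omega;z)$ converges to its value at $z$ for every continuity point $z$ of that distribution function. -/

import Mathlib

open MeasureTheory ProbabilityTheory Filter Topology

noncomputable section

namespace QuenchedCLT

/-- The partial sums `S_n(f) = f ∘ T + f ∘ T² + ⋯ + f ∘ Tⁿ`. -/
def partialSum {Ω : Type*} (T : Ω → Ω) (f : Ω → ℝ) (n : ℕ) (ω : Ω) : ℝ :=
  ∑ i ∈ Finset.Icc 1 n, f (T^[i] ω)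

/-- The σ-algebra `σ{X_1, X_2, …}` generated by `X_i = f ∘ Tⁱ`, `i ≥ 1`. -/
@[reducible]
def futureSigma {Ω : Type*} (T : Ω → Ω) (f : Ω → ℝ) : MeasurableSpace Ω :=
  ⨆ i : {i : ℕ // 1 ≤ i}, MeasurableSpace.comap (fun ω => f (T^[i] ω)) inferInstance

/-- The martingale difference space: square integrable, `m`-measurable functions `g` with
`E(g ∘ T | m) = 0`. -/
def martingaleDifferenceSpace {Ω : Type*} [MeasurableSpace Ω] (μ : Measure Ω) (T : Ω → Ω)
    (m : MeasurableSpace Ω) : Set (Ω → ℝ) :=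
  {g | Measurable[m] g ∧ MemLp g 2 μ ∧ μ[g ∘ T | m] =ᵐ[μ] 0}

/-- `κ` is a regular conditional probability on the σ-algebra `mB` given the σ-algebra `m`:
`κ ω` is a probability measure on `mB` for every `ω`, and for every `B ∈ mB` the function
`ω ↦ κ ω B` is a version of `μ(B | m)` (its `m`-measurability is part of being a kernel). -/
structure IsRegularCondProb {Ω : Type*} [MeasurableSpace Ω] (μ : Measure Ω)
    (m mB : MeasurableSpace Ω) (κ : Kernel[m, mB] Ω Ω) : Prop where
  isProbabilityMeasure : ∀ ω, IsProbabilityMeasure (κ ω)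
  ae_eq_condProb : ∀ B : Set Ω, MeasurableSet[mB] B → (fun ω => (κ ω).real B) =ᵐ[μ] μ⟦B | m⟧

/-- The conditional distribution function `G_n(ω; z) = μ_ω {S_n(f) / √n ≤ z}`. -/
def condDistFun {Ω : Type*} (T : Ω → Ω) (f : Ω → ℝ) {m : MeasurableSpace Ω}
    (κ : Kernel[m, futureSigma T f] Ω Ω) (n : ℕ) (ω : Ω) (z : ℝ) : ℝ :=
  (κ ω).real {ω' | partialSum T f n ω' / √(n : ℝ) ≤ z}

/-- Weak convergence of distribution functions: pointwise convergence at every continuity point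
of the limit. -/
def DistFunTendsto (G : ℕ → ℝ → ℝ) (G' : ℝ → ℝ) : Prop :=
  ∀ z : ℝ, ContinuousAt G' z → Tendsto (fun n => G n z) atTop (𝓝 (G' z))

end QuenchedCLT

end

/-! McLeish's product argument is run conditionally on `F 0`. If the `Y i` are bounded martingale
differences, then `∏ (1 + I t Y i / √n)` has conditional expectation 1. When the averages of `Y i ^
2` tend to `v`, expanding the logarithm shows that this product is asymptotically `exp (t² v / 2)`
times `exp (I t ∑ Y i / √n)` (`tendsto_prod_one_add_I_mul`). If the products are uniformly bounded,
conditional bounded convergence gives conditional characteristic functions tending to `exp (-t² v /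
2)` (`ae_tendsto_condExp_exp`).

Boundedness is arranged in two ways. The variable `X i = f ∘ T^(i+1)` is truncated at `√(i+1)` and
recentred; since `f` is square integrable, the total error is a.e. `o(√n)`. The product is then
stopped once the sum of squares exceeds `n (v + 1)`, which a.e. eventually never happens. Birkhoff's
theorem for `f²`, proved here from a maximal function, identifies `v = ∫ f²`.

The conditional characteristic functions are those of the kernel. Their exceptional null set depends
on `t`; Fubini gives, for a.e. `ω`, convergence for a.e. `t`. An increment inequality extends this
to every `t`, and Lévy's continuity theorem concludes. -/

namespace QuenchedCLT

/-! ### Deterministic estimates for real sequences. -/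

/-- Comparing consecutive averages gives `y n ^ 2 = o(n)`; the finitely many early terms are
absorbed by letting `n` grow. -/
theorem eventually_forall_lt_sq_le {y : ℕ → ℝ} {v : ℝ}
    (h : Tendsto (fun n : ℕ => (∑ i ∈ Finset.range n, y i ^ 2) / n) atTop (𝓝 v))
    {ε : ℝ} (hε : 0 < ε) :
    ∀ᶠ n : ℕ in atTop, ∀ i < n, y i ^ 2 ≤ ε * n := by
  have h1 : Tendsto (fun n : ℕ => y n ^ 2 / ((n : ℝ) + 1)) atTop (𝓝 0) := by
    have h2 : Tendsto (fun n : ℕ => (∑ i ∈ Finset.range (n + 1), y i ^ 2) / ((n + 1 : ℕ) : ℝ)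
        - (∑ i ∈ Finset.range n, y i ^ 2) / n * (n / ((n : ℝ) + 1))) atTop (𝓝 (v - v * 1)) :=
      (h.comp (tendsto_add_atTop_nat 1)).sub (h.mul (tendsto_natCast_div_add_atTop (1 : ℝ)))
    rw [mul_one, sub_self] at h2
    refine h2.congr' ?_
    filter_upwards [eventually_gt_atTop 0] with n hn
    have : (n : ℝ) ≠ 0 := by positivity
    rw [Finset.sum_range_succ]
    push_cast
    field_simp
    ring
  obtain ⟨N, hN⟩ := eventually_atTop.1 (h1.eventually_le_const hε)
  have h3 : Tendsto (fun n : ℕ => ε * (n : ℝ)) atTop atTop :=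
    tendsto_natCast_atTop_atTop.const_mul_atTop hε
  filter_upwards [h3.eventually_ge_atTop (∑ j ∈ Finset.range N, y j ^ 2)] with n hn i hi
  by_cases hiN : i < N
  · exact (Finset.single_le_sum (f := fun j => y j ^ 2) (fun j _ => sq_nonneg _)
      (Finset.mem_range.2 hiN)).trans hn
  · have h4 := hN i (not_lt.1 hiN)
    rw [div_le_iff₀ (by positivity)] at h4
    have : (i : ℝ) + 1 ≤ n := by exact_mod_cast hi
    exact h4.trans (by gcongr)

theorem norm_log_one_add_I_mul_sub_le {x : ℝ} (hx : |x| ≤ 1 / 2) :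
    ‖Complex.log (1 + Complex.I * x) - (Complex.I * x + (x : ℂ) ^ 2 / 2)‖ ≤ |x| * x ^ 2 := by
  have hz : ‖Complex.I * (x : ℂ)‖ = |x| := by simp
  have h := Complex.norm_log_sub_logTaylor_le 2 (z := Complex.I * x) (by rw [hz]; linarith)
  rw [hz] at h
  have h1 : Complex.logTaylor (2 + 1) (Complex.I * x) = Complex.I * x + (x : ℂ) ^ 2 / 2 := by
    simp only [Complex.logTaylor, Finset.sum_range_succ, Finset.sum_range_zero]
    norm_num
    rw [mul_pow, Complex.I_sq]
    ring
  rw [h1] at h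
  refine h.trans ?_
  have h2 : (1 - |x|)⁻¹ ≤ 2 := by
    rw [inv_le_comm₀ (by linarith) (by norm_num)]; linarith
  have h3 : |x| * x ^ 2 = |x| ^ 3 := by rw [← sq_abs x]; ring
  rw [h3]
  have h4 : 0 ≤ |x| ^ 3 := by positivity
  norm_num
  nlinarith

theorem tendsto_sq_div_sqrt {y : ℕ → ℝ} {v : ℝ} (t : ℝ)
    (h : Tendsto (fun n : ℕ => (∑ i ∈ Finset.range n, y i ^ 2) / n) atTop (𝓝 v)) :
    Tendsto (fun n : ℕ => ∑ i ∈ Finset.range n, (t * y i / √(n : ℝ)) ^ 2) atTop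
      (𝓝 (t ^ 2 * v)) := by
  refine (h.const_mul (t ^ 2)).congr fun n => ?_
  simp only [div_pow, mul_pow, Real.sq_sqrt (Nat.cast_nonneg n)]
  rw [← Finset.sum_div, ← Finset.mul_sum]
  ring

/-- The deterministic core of McLeish's argument. -/
theorem tendsto_prod_one_add_I_mul {y : ℕ → ℝ} {v : ℝ} (t : ℝ)
    (h : Tendsto (fun n : ℕ => (∑ i ∈ Finset.range n, y i ^ 2) / n) atTop (𝓝 v)) :
    Tendsto (fun n : ℕ => (∏ i ∈ Finset.range n, (1 + Complex.I * ((t * y i / √(n : ℝ) : ℝ) : ℂ)))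
      * Complex.exp (-(Complex.I * ((∑ i ∈ Finset.range n, t * y i / √(n : ℝ) : ℝ) : ℂ))))
      atTop (𝓝 (Complex.exp ((t ^ 2 * v / 2 : ℝ) : ℂ))) := by
  have hsq := tendsto_sq_div_sqrt t h
  have hmax : ∀ ε > 0, ∀ᶠ n : ℕ in atTop, ∀ i < n, |t * y i / √(n : ℝ)| ≤ ε := by
    intro ε hε
    have hδ : 0 < ε ^ 2 / (t ^ 2 + 1) := by positivity
    filter_upwards [eventually_forall_lt_sq_le h hδ, eventually_gt_atTop 0] with n hn hn0 i hi
    have hn0' : (0 : ℝ) < n := by exact_mod_cast hn0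
    refine abs_le_of_sq_le_sq ?_ hε.le
    rw [div_pow, Real.sq_sqrt hn0'.le, div_le_iff₀ hn0', mul_pow]
    have h1 := hn i hi
    rw [div_mul_eq_mul_div, le_div_iff₀ (by positivity)] at h1
    nlinarith [sq_nonneg (y i)]
  have herr : Tendsto (fun n : ℕ => ∑ i ∈ Finset.range n,
      (Complex.log (1 + Complex.I * ((t * y i / √(n : ℝ) : ℝ) : ℂ))
        - (Complex.I * ((t * y i / √(n : ℝ) : ℝ) : ℂ) + ((t * y i / √(n : ℝ) : ℝ) : ℂ) ^ 2 / 2)))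
      atTop (𝓝 0) := by
    rw [Metric.tendsto_atTop']
    have hv : 0 ≤ t ^ 2 * v := ge_of_tendsto' hsq fun n => Finset.sum_nonneg fun i _ => sq_nonneg _
    intro ε hε
    have hδ : 0 < min (1 / 2) (ε / (2 * (t ^ 2 * v + 1))) := by positivity
    obtain ⟨N, hN⟩ := eventually_atTop.1 ((hmax _ hδ).and
      (hsq.eventually_lt_const (lt_add_one (t ^ 2 * v))))
    refine ⟨N, fun n hn => ?_⟩
    obtain ⟨hn1, hn2⟩ := hN n hn.le
    rw [dist_zero_right]
    calc _ ≤ ∑ i ∈ Finset.range n, ε / (2 * (t ^ 2 * v + 1)) * (t * y i / √(n : ℝ)) ^ 2 := by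
          refine (norm_sum_le _ _).trans (Finset.sum_le_sum fun i hi => ?_)
          have h1 := hn1 i (Finset.mem_range.1 hi)
          refine (norm_log_one_add_I_mul_sub_le (h1.trans (min_le_left _ _))).trans ?_
          gcongr
          exact h1.trans (min_le_right _ _)
      _ ≤ ε / (2 * (t ^ 2 * v + 1)) * (t ^ 2 * v + 1) := by
          rw [← Finset.mul_sum]; gcongr
      _ = ε / 2 := by field_simp
      _ < ε := half_lt_self hε
  -- The linear terms of the logarithms cancel against `exp (-I ∑ ..)`, leaving half the sum of
  -- squares and a vanishing remainder.
  have hlim : Tendsto (fun n : ℕ => Complex.exp ((∑ i ∈ Finset.range n,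
      (Complex.log (1 + Complex.I * ((t * y i / √(n : ℝ) : ℝ) : ℂ))
        - (Complex.I * ((t * y i / √(n : ℝ) : ℝ) : ℂ) + ((t * y i / √(n : ℝ) : ℝ) : ℂ) ^ 2 / 2)))
      + (((∑ i ∈ Finset.range n, (t * y i / √(n : ℝ)) ^ 2) / 2 : ℝ) : ℂ)))
      atTop (𝓝 (Complex.exp (0 + ((t ^ 2 * v / 2 : ℝ) : ℂ)))) :=
    (Complex.continuous_exp.tendsto _).comp
      (herr.add ((Complex.continuous_ofReal.tendsto _).comp (hsq.div_const 2)))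
  rw [zero_add] at hlim
  refine hlim.congr' ?_
  filter_upwards with n
  rw [Finset.sum_sub_distrib, Finset.sum_add_distrib]
  have : ∏ i ∈ Finset.range n, (1 + Complex.I * ((t * y i / √(n : ℝ) : ℝ) : ℂ))
      = Complex.exp (∑ i ∈ Finset.range n,
        Complex.log (1 + Complex.I * ((t * y i / √(n : ℝ) : ℝ) : ℂ))) := by
    rw [Complex.exp_sum]
    refine Finset.prod_congr rfl fun i _ => (Complex.exp_log fun h0 => ?_).symm
    simpa using congrArg Complex.re h0
  rw [this, ← Complex.exp_add]
  congr 1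
  rw [Complex.ofReal_sum, Complex.ofReal_div, Complex.ofReal_sum, Finset.mul_sum, Finset.sum_div]
  simp only [Complex.ofReal_pow, Complex.ofReal_ofNat]
  ring

/-- Each `|x i|` is at most the root of the sum of squares, and each `|y i - x i|` at most the whole
error sum. Factoring `y² - x²` then bounds the difference of averages by `2 √a q + q²`. -/
theorem tendsto_sum_sq_div_of_sum_abs_sub {x y : ℕ → ℝ} {v : ℝ}
    (h : Tendsto (fun n : ℕ => (∑ i ∈ Finset.range n, x i ^ 2) / n) atTop (𝓝 v))
    (he : Tendsto (fun n : ℕ => (∑ i ∈ Finset.range n, |y i - x i|) / √(n : ℝ)) atTop (𝓝 0)) :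
    Tendsto (fun n : ℕ => (∑ i ∈ Finset.range n, y i ^ 2) / n) atTop (𝓝 v) := by
  set q : ℕ → ℝ := fun n => (∑ i ∈ Finset.range n, |y i - x i|) / √(n : ℝ) with hq
  set a : ℕ → ℝ := fun n => (∑ i ∈ Finset.range n, x i ^ 2) / n with ha
  have hlim : Tendsto (fun n => 2 * √(a n) * q n + q n ^ 2) atTop (𝓝 0) := by
    simpa using ((h.sqrt.const_mul 2).mul he).add (he.pow 2)
  have hd : Tendsto (fun n : ℕ => (∑ i ∈ Finset.range n, y i ^ 2) / n - a n) atTop (𝓝 0) := by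
    refine squeeze_zero_norm' ?_ hlim
    filter_upwards [eventually_gt_atTop 0] with n hn
    have hn' : (0 : ℝ) < n := by exact_mod_cast hn
    set E := ∑ i ∈ Finset.range n, |y i - x i| with hE
    set A := ∑ i ∈ Finset.range n, x i ^ 2 with hA
    have hE0 : 0 ≤ E := Finset.sum_nonneg fun i _ => abs_nonneg _
    have h1 : |∑ i ∈ Finset.range n, y i ^ 2 - A| ≤ 2 * √A * E + E ^ 2 := by
      rw [hA, ← Finset.sum_sub_distrib]
      calc _ ≤ ∑ i ∈ Finset.range n, (2 * √A * |y i - x i| + E * |y i - x i|) := by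
            refine (Finset.abs_sum_le_sum_abs _ _).trans (Finset.sum_le_sum fun i hi => ?_)
            have h2 : |x i| ≤ √A := Real.abs_le_sqrt
              (Finset.single_le_sum (f := fun j => x j ^ 2) (fun j _ => sq_nonneg _) hi)
            have h3 : |y i - x i| ≤ E :=
              Finset.single_le_sum (f := fun j => |y j - x j|) (fun j _ => abs_nonneg _) hi
            have h4 : |y i + x i| ≤ 2 * √A + E := by
              calc |y i + x i| = |2 * x i + (y i - x i)| := by congr 1; ring
                _ ≤ |2 * x i| + |y i - x i| := abs_add_le _ _
                _ ≤ _ := by rw [abs_mul, abs_two]; gcongr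
            calc |y i ^ 2 - x i ^ 2| = |y i + x i| * |y i - x i| := by rw [← abs_mul]; congr 1; ring
              _ ≤ (2 * √A + E) * |y i - x i| := by gcongr
              _ = _ := by ring
        _ = _ := by rw [Finset.sum_add_distrib, ← Finset.mul_sum, ← Finset.mul_sum, ← hE]; ring
    rw [Real.norm_eq_abs, ha, ← sub_div, abs_div, abs_of_pos hn', div_le_iff₀ hn']
    refine h1.trans (le_of_eq ?_)
    have hs : √(n : ℝ) ≠ 0 := by positivity
    have hs2 : √(n : ℝ) ^ 2 = n := Real.sq_sqrt hn'.le
    simp only [hq, Real.sqrt_div' _ hn'.le]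
    field_simp
    rw [hs2]
  simpa using hd.add h

/-- A case of Kronecker's lemma, by dominated convergence for series: for `i < n` the term `c i /
√n` is at most `c i / √(i+1)`. -/
theorem tendsto_sum_div_sqrt_of_summable {c : ℕ → ℝ} (hc : ∀ i, 0 ≤ c i)
    (h : Summable fun i : ℕ => c i / √((i : ℝ) + 1)) :
    Tendsto (fun n : ℕ => (∑ i ∈ Finset.range n, c i) / √(n : ℝ)) atTop (𝓝 0) := by
  have key : Tendsto (fun n : ℕ => ∑' i : ℕ, if i < n then c i / √(n : ℝ) else 0) atTop
      (𝓝 (∑' _ : ℕ, (0 : ℝ))) := by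
    refine tendsto_tsum_of_dominated_convergence h (fun i => ?_) ?_
    · have h1 : Tendsto (fun n : ℕ => c i / √(n : ℝ)) atTop (𝓝 0) :=
        (Real.tendsto_sqrt_atTop.comp tendsto_natCast_atTop_atTop).const_div_atTop _
      refine h1.congr' ?_
      filter_upwards [eventually_gt_atTop i] with n hn
      simp [hn]
    · filter_upwards with n i
      split_ifs with hi
      · have h2 : (i : ℝ) + 1 ≤ n := by exact_mod_cast hi
        rw [Real.norm_eq_abs, abs_of_nonneg (div_nonneg (hc i) (Real.sqrt_nonneg _))]
        gcongr
        exact hc i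
      · simpa using div_nonneg (hc i) (Real.sqrt_nonneg _)
  rw [tsum_zero] at key
  refine key.congr fun n => ?_
  rw [tsum_eq_sum (s := Finset.range n) (fun i hi => if_neg (by simpa using hi)), Finset.sum_div]
  exact Finset.sum_congr rfl fun i hi => by simp [Finset.mem_range.1 hi]

/-! ### Birkhoff's ergodic theorem. -/

/-- The maximal function `max (S₁, …, Sₙ₊₁)` of the Birkhoff sums of `g`, defined recursively. -/
def birkhoffMax {Ω : Type*} (T : Ω → Ω) (g : Ω → ℝ) : ℕ → Ω → ℝ
  | 0 => g
  | n + 1 => fun ω => g ω + max 0 (birkhoffMax T g n (T ω))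

section Birkhoff

variable {Ω : Type*} {T : Ω → Ω} {g : Ω → ℝ}

theorem birkhoffMax_succ (n : ℕ) (ω : Ω) :
    birkhoffMax T g (n + 1) ω = g ω + max 0 (birkhoffMax T g n (T ω)) := rfl

theorem birkhoffMax_le_succ (n : ℕ) (ω : Ω) : birkhoffMax T g n ω ≤ birkhoffMax T g (n + 1) ω := by
  induction n generalizing ω with
  | zero => simp [birkhoffMax]
  | succ n ih =>
    rw [birkhoffMax_succ, birkhoffMax_succ]
    gcongr
    exact ih _

theorem monotone_birkhoffMax (ω : Ω) : Monotone fun n => birkhoffMax T g n ω :=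
  monotone_nat_of_le_succ fun n => birkhoffMax_le_succ n ω

theorem birkhoffSum_le_birkhoffMax (n : ℕ) (ω : Ω) :
    birkhoffSum T g (n + 1) ω ≤ birkhoffMax T g n ω := by
  induction n generalizing ω with
  | zero => simp [birkhoffMax]
  | succ n ih =>
    rw [birkhoffSum_succ', birkhoffMax_succ]
    gcongr
    exact (ih _).trans (le_max_right _ _)

theorem bddAbove_birkhoffMax_comp_iff (ω : Ω) :
    BddAbove (Set.range fun n => birkhoffMax T g n (T ω)) ↔
      BddAbove (Set.range fun n => birkhoffMax T g n ω) := by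
  simp only [bddAbove_def, Set.forall_mem_range]
  constructor
  · rintro ⟨C, hC⟩
    refine ⟨g ω + max 0 C, fun n => (birkhoffMax_le_succ n ω).trans ?_⟩
    rw [birkhoffMax_succ]
    gcongr
    exact hC n
  · rintro ⟨C, hC⟩
    refine ⟨C - g ω, fun n => ?_⟩
    have := hC (n + 1)
    rw [birkhoffMax_succ] at this
    linarith [le_max_right 0 (birkhoffMax T g n (T ω))]

variable [MeasurableSpace Ω] {μ : Measure Ω}

theorem measurable_birkhoffMax (hT : Measurable T) (hg : Measurable g) (n : ℕ) :
    Measurable (birkhoffMax T g n) := by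
  induction n with
  | zero => exact hg
  | succ n ih => exact hg.add (measurable_const.max (ih.comp hT))

theorem integrable_birkhoffMax (hT : MeasurePreserving T μ μ) (hg : Integrable g μ) (n : ℕ) :
    Integrable (birkhoffMax T g n) μ := by
  induction n with
  | zero => exact hg
  | succ n ih =>
    refine hg.add ?_
    simpa [max_comm] using (hT.integrable_comp_of_integrable ih).pos_part

/-- With `M n` the maximal function, `M (n+1) - M n ∘ T` is `g` plus the negative part of `M n ∘ T`.
It equals `g` once `M n ∘ T ≥ 0`, while by invariance its integral is `∫ (M (n+1) - M n) ≥ 0`. -/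
theorem integral_nonneg_of_not_bddAbove (hT : MeasurePreserving T μ μ) (hg : Integrable g μ)
    (h : ∀ᵐ ω ∂μ, ¬ BddAbove (Set.range fun n => birkhoffMax T g n ω)) : 0 ≤ ∫ ω, g ω ∂μ := by
  have hM := integrable_birkhoffMax hT hg
  have hMT n : Integrable (fun ω => birkhoffMax T g n (T ω)) μ :=
    hT.integrable_comp_of_integrable (hM n)
  have hlim : Tendsto (fun n => ∫ ω, (birkhoffMax T g (n + 1) ω - birkhoffMax T g n (T ω)) ∂μ) atTop
      (𝓝 (∫ ω, g ω ∂μ)) := by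
    refine tendsto_integral_of_dominated_convergence (fun ω => |g ω| + |g (T ω)|)
      (fun n => ((hM _).sub (hMT n)).aestronglyMeasurable)
      (hg.abs.add (hT.integrable_comp_of_integrable hg).abs) (fun n => ?_) ?_
    · refine ae_of_all _ fun ω => ?_
      -- This lower bound keeps the negative part of the maximal function below `|g ∘ T|`, giving
      -- the dominating function.
      have h0 : g (T ω) ≤ birkhoffMax T g n (T ω) :=
        monotone_birkhoffMax (T := T) (g := g) (T ω) (Nat.zero_le n)
      rw [birkhoffMax_succ, Real.norm_eq_abs, add_sub_assoc]
      refine (abs_add_le _ _).trans (add_le_add_right ?_ _)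
      rw [abs_le]
      constructor
      · linarith [le_max_right 0 (birkhoffMax T g n (T ω)), abs_nonneg (g (T ω))]
      · rw [sub_le_iff_le_add, max_le_iff]
        constructor
        · linarith [neg_abs_le (g (T ω))]
        · linarith [abs_nonneg (g (T ω))]
    · filter_upwards [h] with ω hω
      rw [← bddAbove_birkhoffMax_comp_iff] at hω
      have ht := tendsto_atTop_atTop_of_monotone' (monotone_birkhoffMax (T ω)) hω
      refine tendsto_const_nhds.congr' ?_
      filter_upwards [ht.eventually_ge_atTop 0] with n hn
      rw [birkhoffMax_succ, max_eq_right hn]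
      ring
  refine ge_of_tendsto' hlim fun n => ?_
  rw [integral_sub (hM _) (hMT n), sub_nonneg]
  have : ∫ ω, birkhoffMax T g n (T ω) ∂μ = ∫ ω, birkhoffMax T g n ω ∂μ := by
    have h1 := integral_map hT.measurable.aemeasurable (f := birkhoffMax T g n)
      (by rw [hT.map_eq]; exact (hM n).aestronglyMeasurable)
    rw [hT.map_eq] at h1
    exact h1.symm
  rw [this]
  exact integral_mono (hM n) (hM _) fun ω => birkhoffMax_le_succ n ω

/-- Boundedness of the maximal functions is a `T`-invariant event, so by ergodicity it holds a.e. or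
fails a.e.; the latter would force a nonnegative integral. -/
theorem ae_bddAbove_birkhoffSum (hT : Ergodic T μ) (hgm : Measurable g) (hg : Integrable g μ)
    (hneg : ∫ ω, g ω ∂μ < 0) :
    ∀ᵐ ω ∂μ, BddAbove (Set.range fun n => birkhoffSum T g (n + 1) ω) := by
  have hA : MeasurableSet {ω | BddAbove (Set.range fun n => birkhoffMax T g n ω)} :=
    measurableSet_bddAbove_range fun n => measurable_birkhoffMax hT.measurable hgm n
  rcases hT.ae_mem_or_ae_notMem hA (by ext ω; exact bddAbove_birkhoffMax_comp_iff ω) with h | h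
  · filter_upwards [h] with ω hω
    obtain ⟨C, hC⟩ := hω
    refine ⟨C, ?_⟩
    rintro _ ⟨n, rfl⟩
    exact (birkhoffSum_le_birkhoffMax n ω).trans (hC ⟨n, rfl⟩)
  · exact absurd (integral_nonneg_of_not_bddAbove hT.toMeasurePreserving hg h) (not_le.2 hneg)

theorem ae_eventually_birkhoffSum_div_lt [IsProbabilityMeasure μ] (hT : Ergodic T μ)
    (hgm : Measurable g) (hg : Integrable g μ) {a : ℝ} (ha : ∫ ω, g ω ∂μ < a) :
    ∀ᵐ ω ∂μ, ∀ᶠ n : ℕ in atTop, birkhoffSum T g n ω / n < a := by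
  obtain ⟨b, hb, hba⟩ := exists_between ha
  have h := ae_bddAbove_birkhoffSum hT (g := fun ω => g ω - b) (hgm.sub_const b)
    (hg.sub (integrable_const b)) (by
      rw [integral_sub hg (integrable_const b)]; simpa using hb)
  filter_upwards [h] with ω hω
  obtain ⟨C, hC⟩ := hω
  have hlim : Tendsto (fun n : ℕ => (a - b) * (n : ℝ)) atTop atTop :=
    tendsto_natCast_atTop_atTop.const_mul_atTop (sub_pos.2 hba)
  filter_upwards [hlim.eventually_gt_atTop C, eventually_gt_atTop 0] with n hn hn0
  have h1 : birkhoffSum T (fun ω => g ω - b) n ω ≤ C := by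
    obtain ⟨k, rfl⟩ := Nat.exists_eq_succ_of_ne_zero hn0.ne'
    exact hC ⟨k, rfl⟩
  have h2 : birkhoffSum T (fun ω => g ω - b) n ω = birkhoffSum T g n ω - n * b := by
    simp [birkhoffSum, Finset.sum_sub_distrib]
  rw [div_lt_iff₀ (by exact_mod_cast hn0)]
  linarith

/-- **Birkhoff's pointwise ergodic theorem** for ergodic transformations. -/
theorem ae_tendsto_birkhoffSum_div [IsProbabilityMeasure μ] (hT : Ergodic T μ)
    (hgm : Measurable g) (hg : Integrable g μ) :
    ∀ᵐ ω ∂μ, Tendsto (fun n : ℕ => birkhoffSum T g n ω / n) atTop (𝓝 (∫ ω, g ω ∂μ)) := by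
  -- Stated for every integrable function so that applying it to `-g` yields the lower bound.
  have hup : ∀ {g : Ω → ℝ}, Measurable g → Integrable g μ → ∀ᵐ ω ∂μ, ∀ k : ℕ,
      ∀ᶠ n : ℕ in atTop, birkhoffSum T g n ω / n < ∫ ω, g ω ∂μ + 1 / ((k : ℝ) + 1) :=
    fun hgm hg => ae_all_iff.2 fun k =>
      ae_eventually_birkhoffSum_div_lt hT hgm hg (lt_add_of_pos_right _ (by positivity))
  filter_upwards [hup hgm hg, hup hgm.neg hg.neg] with ω h1 h2
  rw [Metric.tendsto_nhds]
  intro ε hε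
  obtain ⟨k, hk⟩ := exists_nat_one_div_lt hε
  filter_upwards [h1 k, h2 k] with n hn1 hn2
  have h3 : birkhoffSum T (-g) n ω = - birkhoffSum T g n ω := by simp [birkhoffSum]
  have h4 : ∫ ω, (-g) ω ∂μ = - ∫ ω, g ω ∂μ := integral_neg _
  rw [h3, h4, neg_div] at hn2
  rw [Real.dist_eq, abs_lt]
  constructor <;> linarith

end Birkhoff

/-! ### Characteristic functions and weak convergence. -/

/-- Jensen's inequality applied to `|exp (itx) - exp (isx)|² = 2 (1 - cos ((t - s) x))`. It controls
oscillation anywhere by behaviour near the origin. -/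
theorem norm_charFun_sub_charFun_le (ν : Measure ℝ) [IsProbabilityMeasure ν] (t s : ℝ) :
    ‖charFun ν t - charFun ν s‖ ≤ √(2 * ‖1 - charFun ν (t - s)‖) := by
  have hi (u : ℝ) : Integrable (fun x : ℝ => Complex.exp (u * x * Complex.I)) ν := by
    refine Integrable.of_bound (by fun_prop) 1 (ae_of_all _ fun x => ?_)
    rw [← Complex.ofReal_mul, Complex.norm_exp_ofReal_mul_I]
  refine Real.le_sqrt_of_sq_le ?_
  have hn (x : ℝ) : ‖Complex.exp (t * x * Complex.I) - Complex.exp (s * x * Complex.I)‖ ^ 2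
      = 2 * (1 - Complex.exp ((t - s : ℝ) * x * Complex.I)).re := by
    have e (u : ℝ) : Complex.exp (u * x * Complex.I)
        = ⟨Real.cos (u * x), Real.sin (u * x)⟩ := by
      rw [← Complex.ofReal_mul]
      apply Complex.ext
      · rw [Complex.exp_ofReal_mul_I_re]
      · rw [Complex.exp_ofReal_mul_I_im]
    rw [e, e, e, Complex.sq_norm, Complex.normSq_apply]
    simp only [Complex.sub_re, Complex.sub_im, Complex.one_re]
    rw [sub_mul t s x, Real.cos_sub]
    nlinarith [Real.sin_sq_add_cos_sq (t * x), Real.sin_sq_add_cos_sq (s * x)]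
  have hi' : Integrable (fun x : ℝ => ‖Complex.exp (t * x * Complex.I)
      - Complex.exp (s * x * Complex.I)‖) ν := ((hi t).sub (hi s)).norm
  have hi2 : Integrable (fun x : ℝ => ‖Complex.exp (t * x * Complex.I)
      - Complex.exp (s * x * Complex.I)‖ ^ 2) ν := by
    simp_rw [hn]
    exact (((integrable_const _).sub (hi (t - s))).re).const_mul 2
  rw [charFun_apply_real, charFun_apply_real, charFun_apply_real, ← integral_sub (hi t) (hi s)]
  calc ‖∫ x : ℝ, (Complex.exp (t * x * Complex.I) - Complex.exp (s * x * Complex.I)) ∂ν‖ ^ 2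
      ≤ (∫ x : ℝ, ‖Complex.exp (t * x * Complex.I) - Complex.exp (s * x * Complex.I)‖ ∂ν) ^ 2 := by
        gcongr
        exact norm_integral_le_integral_norm _
    _ ≤ ∫ x : ℝ, ‖Complex.exp (t * x * Complex.I) - Complex.exp (s * x * Complex.I)‖ ^ 2 ∂ν :=
        (even_two.convexOn_pow).map_integral_le (by fun_prop) isClosed_univ (by simp) hi' hi2
    _ = 2 * (∫ x : ℝ, (1 - Complex.exp ((t - s : ℝ) * x * Complex.I)) ∂ν).re := by
        simp_rw [hn]
        rw [integral_const_mul]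
        congr 1
        exact integral_re ((integrable_const _).sub (hi (t - s)))
    _ ≤ 2 * ‖∫ x : ℝ, (1 - Complex.exp ((t - s : ℝ) * x * Complex.I)) ∂ν‖ := by
        gcongr
        exact Complex.re_le_norm _
    _ = _ := by
        rw [integral_sub (integrable_const _) (hi (t - s))]
        simp

/-- Convergence of characteristic functions at almost every point to a characteristic function
implies convergence at every point. -/
theorem tendsto_charFun_of_ae {ν : ℕ → Measure ℝ} [∀ n, IsProbabilityMeasure (ν n)]
    {ν₀ : Measure ℝ} [IsProbabilityMeasure ν₀]
    (h : ∀ᵐ t : ℝ, Tendsto (fun n => charFun (ν n) t) atTop (𝓝 (charFun ν₀ t))) (t : ℝ) :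
    Tendsto (fun n => charFun (ν n) t) atTop (𝓝 (charFun ν₀ t)) := by
  have h' : ∀ᵐ s : ℝ, Tendsto (fun n => charFun (ν n) (t - s)) atTop (𝓝 (charFun ν₀ (t - s))) :=
    (Measure.measurePreserving_sub_left volume t).quasiMeasurePreserving.ae h
  rw [Metric.tendsto_nhds]
  intro ε hε
  have hc : ContinuousAt (fun s => ‖charFun ν₀ t - charFun ν₀ s‖
      + √(2 * ‖1 - charFun ν₀ (t - s)‖)) t := by fun_prop
  have h0 : ∀ᶠ s in 𝓝 t, ‖charFun ν₀ t - charFun ν₀ s‖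
      + √(2 * ‖1 - charFun ν₀ (t - s)‖) < ε / 2 := by
    refine hc.eventually_lt_const ?_
    simpa using hε
  -- Both conditions hold for a.e. `s`, so a good `s` exists arbitrarily near `t`. Convergence at
  -- `s` passes to `t`, with the oscillation of `charFun (ν n)` controlled by convergence at `t -
  -- s`.
  have hd : Dense {s : ℝ | Tendsto (fun n => charFun (ν n) s) atTop (𝓝 (charFun ν₀ s)) ∧
      Tendsto (fun n => charFun (ν n) (t - s)) atTop (𝓝 (charFun ν₀ (t - s)))} :=
    Measure.dense_of_ae (h.and h')
  obtain ⟨s, ⟨hs1, hs2⟩, hs3⟩ := (mem_closure_iff_frequently.1 (hd t)).and_eventually h0 |>.exists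
  have hlim : Tendsto (fun n => √(2 * ‖1 - charFun (ν n) (t - s)‖)
      + ‖charFun (ν n) s - charFun ν₀ s‖ + ‖charFun ν₀ t - charFun ν₀ s‖) atTop
      (𝓝 (√(2 * ‖1 - charFun ν₀ (t - s)‖) + ‖charFun ν₀ s - charFun ν₀ s‖
        + ‖charFun ν₀ t - charFun ν₀ s‖)) :=
    ((((tendsto_const_nhds.sub hs2).norm.const_mul 2).sqrt.add
      (hs1.sub tendsto_const_nhds).norm).add tendsto_const_nhds)
  filter_upwards [hlim.eventually_lt_const (u := ε) (by rw [sub_self, norm_zero]; linarith)]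
    with n hn
  rw [dist_eq_norm]
  refine lt_of_le_of_lt ?_ hn
  have := norm_charFun_sub_charFun_le (ν n) t s
  calc ‖charFun (ν n) t - charFun ν₀ t‖ = ‖(charFun (ν n) t - charFun (ν n) s)
        + (charFun (ν n) s - charFun ν₀ s) - (charFun ν₀ t - charFun ν₀ s)‖ := by
          congr 1; ring
    _ ≤ _ := (norm_sub_le _ _).trans (by gcongr; exact (norm_add_le _ _).trans (by gcongr))

theorem distFunTendsto_cdf_of_ae_charFun {ν : ℕ → Measure ℝ} [∀ n, IsProbabilityMeasure (ν n)]
    {ν₀ : Measure ℝ} [IsProbabilityMeasure ν₀]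
    (h : ∀ᵐ t : ℝ, Tendsto (fun n => charFun (ν n) t) atTop (𝓝 (charFun ν₀ t))) :
    DistFunTendsto (fun n z => (ν n).real (Set.Iic z)) (fun z => cdf ν₀ z) := by
  intro z hz
  let P : ℕ → ProbabilityMeasure ℝ := fun n => ⟨ν n, inferInstance⟩
  let P₀ : ProbabilityMeasure ℝ := ⟨ν₀, inferInstance⟩
  have hw : Tendsto P atTop (𝓝 P₀) :=
    ProbabilityMeasure.tendsto_of_tendsto_charFun (tendsto_charFun_of_ae h)
  -- Continuity of the cdf at `z` means no atom there, so the half-line has null frontier and the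
  -- portmanteau theorem applies.
  have hz0 : ν₀ {z} = 0 := by
    rw [← measure_cdf ν₀, StieltjesFunction.measure_singleton,
      (cdf ν₀).mono.continuousAt_iff_leftLim_eq_rightLim.1 hz]
    simp [(cdf ν₀).rightLim_eq]
  have := ProbabilityMeasure.tendsto_measure_of_null_frontier_of_tendsto' hw
    (E := Set.Iic z) (by rw [frontier_Iic]; exact hz0)
  simp only [cdf_eq_real]
  exact (ENNReal.tendsto_toReal (measure_ne_top _ _)).comp this

/-! ### Conditional bounded convergence and McLeish's argument. -/

section Conditional

variable {Ω : Type*} {m mΩ : MeasurableSpace Ω} {μ : Measure Ω} [IsProbabilityMeasure μ]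

/-- Conditional bounded convergence theorem. -/
theorem ae_tendsto_condExp_zero (hm : m ≤ mΩ) {h : ℕ → Ω → ℂ} {C : ℝ}
    (hmeas : ∀ n, AEStronglyMeasurable (h n) μ) (hbdd : ∀ n, ∀ᵐ ω ∂μ, ‖h n ω‖ ≤ C)
    (hlim : ∀ᵐ ω ∂μ, Tendsto (fun n => h n ω) atTop (𝓝 0)) :
    ∀ᵐ ω ∂μ, Tendsto (fun n => (μ[h n | m]) ω) atTop (𝓝 0) := by
  have hbdd' := ae_all_iff.2 hbdd
  -- Tail suprema decrease to 0, so their conditional expectations decrease a.e.; since the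
  -- integrals tend to 0, so does this antitone sequence.
  set g : ℕ → Ω → ℝ := fun n ω => ⨆ k, ‖h (n + k) ω‖ with hg
  have hgm n : AEMeasurable (g n) μ := AEMeasurable.iSup fun k => (hmeas (n + k)).norm.aemeasurable
  have hbA : ∀ ω, (∀ n, ‖h n ω‖ ≤ C) → ∀ n, BddAbove (Set.range fun k => ‖h (n + k) ω‖) :=
    fun ω hω n => ⟨C, by rintro _ ⟨k, rfl⟩; exact hω _⟩
  have hg0 : ∀ n ω, 0 ≤ g n ω := fun n ω => Real.iSup_nonneg fun k => norm_nonneg _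
  have hgb : ∀ n, ∀ᵐ ω ∂μ, ‖g n ω‖ ≤ C := fun n => by
    filter_upwards [hbdd'] with ω hω
    rw [Real.norm_of_nonneg (hg0 n ω)]
    exact ciSup_le fun k => hω _
  have hgi n : Integrable (g n) μ := Integrable.of_bound (hgm n).aestronglyMeasurable C (hgb n)
  have hhi n : Integrable (h n) μ := Integrable.of_bound (hmeas n) C (hbdd n)
  have hle n : ∀ᵐ ω ∂μ, ‖h n ω‖ ≤ g n ω := by
    filter_upwards [hbdd'] with ω hω
    exact le_ciSup (hbA ω hω n) 0
  have hanti n : ∀ᵐ ω ∂μ, g (n + 1) ω ≤ g n ω := by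
    filter_upwards [hbdd'] with ω hω
    refine ciSup_le fun k => ?_
    have := le_ciSup (hbA ω hω n) (1 + k)
    rwa [← add_assoc] at this
  have hgl : ∀ᵐ ω ∂μ, Tendsto (fun n => g n ω) atTop (𝓝 0) := by
    filter_upwards [hlim] with ω hω
    rw [Metric.tendsto_atTop] at hω ⊢
    intro ε hε
    obtain ⟨N, hN⟩ := hω (ε / 2) (half_pos hε)
    refine ⟨N, fun n hn => ?_⟩
    rw [Real.dist_0_eq_abs, abs_of_nonneg (hg0 n ω)]
    refine (ciSup_le fun k => ?_).trans_lt (half_lt_self hε)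
    have := hN (n + k) (by omega)
    rw [dist_zero_right] at this
    exact this.le
  have hint : Tendsto (fun n => ∫ ω, g n ω ∂μ) atTop (𝓝 (∫ _, 0 ∂μ)) :=
    tendsto_integral_of_dominated_convergence (fun _ => C)
      (fun n => (hgm n).aestronglyMeasurable) (integrable_const C) hgb hgl
  have hcond : ∀ᵐ ω ∂μ, Tendsto (fun n => (μ[g n | m]) ω) atTop (𝓝 0) := by
    refine tendsto_of_integral_tendsto_of_antitone (fun n => integrable_condExp)
      (integrable_zero _ _ _) ?_ ?_ ?_
    · simpa only [integral_condExp hm] using hint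
    · have : ∀ᵐ ω ∂μ, ∀ n, (μ[g (n + 1) | m]) ω ≤ (μ[g n | m]) ω :=
        ae_all_iff.2 fun n => condExp_mono (hgi _) (hgi _) (hanti n)
      filter_upwards [this] with ω hω using antitone_nat_of_succ_le hω
    · have : ∀ᵐ ω ∂μ, ∀ n, 0 ≤ (μ[g n | m]) ω :=
        ae_all_iff.2 fun n => condExp_nonneg (ae_of_all _ (hg0 n))
      filter_upwards [this] with ω hω n using hω n
  have hcle : ∀ᵐ ω ∂μ, ∀ n, ‖(μ[h n | m]) ω‖ ≤ (μ[g n | m]) ω := ae_all_iff.2 fun n => by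
    filter_upwards [norm_condExp_le (m := m) (μ := μ) (h n),
      condExp_mono (m := m) (hhi n).norm (hgi n) (hle n)] with ω h1 h2 using h1.trans h2
  filter_upwards [hcond, hcle] with ω h1 h2
  exact squeeze_zero_norm h2 h1

theorem stronglyMeasurable_prod_one_add_I_mul {W : ℕ → Ω → ℝ} {n : ℕ}
    (hW : ∀ i < n, StronglyMeasurable[m] (W i)) :
    StronglyMeasurable[m] fun ω => ∏ i ∈ Finset.range n, (1 + Complex.I * (W i ω : ℂ)) := by
  refine Finset.stronglyMeasurable_fun_prod _ fun i hi => ?_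
  exact stronglyMeasurable_const.add
    ((Complex.continuous_ofReal.comp_stronglyMeasurable (hW i (Finset.mem_range.1 hi))).const_mul _)

theorem norm_prod_one_add_I_mul_le (x : ℕ → ℝ) (n : ℕ) :
    ‖∏ i ∈ Finset.range n, (1 + Complex.I * (x i : ℂ))‖
      ≤ Real.exp (∑ i ∈ Finset.range n, x i ^ 2) := by
  rw [norm_prod, Real.exp_sum]
  refine Finset.prod_le_prod (fun i _ => norm_nonneg _) fun i _ => ?_
  have h1 : ‖1 + Complex.I * (x i : ℂ)‖ ^ 2 = 1 + x i ^ 2 := by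
    rw [Complex.sq_norm, Complex.normSq_apply]; simp; ring
  have h2 : 1 + x i ^ 2 ≤ Real.exp (x i ^ 2) := by linarith [Real.add_one_le_exp (x i ^ 2)]
  refine le_trans ?_ h2
  nlinarith [sq_nonneg (x i), norm_nonneg (1 + Complex.I * (x i : ℂ))]

/-- The first `n` factors are `G n`-measurable, so conditioning on `G n` kills the contribution of
`W n`; the tower property descends to `G 0`. -/
theorem condExp_prod_one_add_I_mul {G : Filtration ℕ mΩ} {W : ℕ → Ω → ℝ} {C : ℕ → ℝ}
    (hW : ∀ i, StronglyMeasurable[G (i + 1)] (W i)) (hb : ∀ i, ∀ᵐ ω ∂μ, |W i ω| ≤ C i)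
    (h0 : ∀ i, μ[W i | G i] =ᵐ[μ] 0) (n : ℕ) :
    μ[fun ω => ∏ i ∈ Finset.range n, (1 + Complex.I * (W i ω : ℂ)) | G 0] =ᵐ[μ] 1 := by
  induction n with
  | zero =>
    simp only [Finset.range_zero, Finset.prod_empty]
    rw [condExp_const (G.le 0)]
    rfl
  | succ n ih =>
    set P : Ω → ℂ := fun ω => ∏ i ∈ Finset.range n, (1 + Complex.I * (W i ω : ℂ)) with hP
    have hPm : StronglyMeasurable[G n] P := stronglyMeasurable_prod_one_add_I_mul
      fun i hi => (hW i).mono (G.mono (Nat.succ_le_of_lt hi))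
    have hPb : ∀ᵐ ω ∂μ, ‖P ω‖ ≤ Real.exp (∑ i ∈ Finset.range n, C i ^ 2) := by
      filter_upwards [ae_all_iff.2 hb] with ω hω
      refine (norm_prod_one_add_I_mul_le _ _).trans ?_
      refine Real.exp_le_exp.2 (Finset.sum_le_sum fun i _ => ?_)
      exact sq_le_sq' (neg_le_of_abs_le (hω i)) (le_of_abs_le (hω i))
    have hPi : Integrable P μ :=
      Integrable.of_bound (hPm.mono (G.le n)).aestronglyMeasurable _ hPb
    have hWi : Integrable (W n) μ := Integrable.of_bound
      ((hW n).mono (G.le _)).aestronglyMeasurable (C n) (hb n)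
    have hIPm : StronglyMeasurable[G n] fun ω => Complex.I * P ω := hPm.const_mul _
    have hprod : Integrable (W n • fun ω => Complex.I * P ω) μ := by
      have : Integrable (fun ω => W n ω • (Complex.I * P ω)) μ :=
        (hPi.const_mul Complex.I).bdd_smul (C n) ((hW n).mono (G.le _)).aestronglyMeasurable (hb n)
      exact this
    have heq : (fun ω => ∏ i ∈ Finset.range (n + 1), (1 + Complex.I * (W i ω : ℂ)))
        = P + W n • fun ω => Complex.I * P ω := by
      ext ω
      simp only [Finset.prod_range_succ, Pi.add_apply, Pi.smul_apply', Complex.real_smul, hP]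
      ring
    have hz : μ[W n • (fun ω => Complex.I * P ω) | G 0] =ᵐ[μ] 0 := by
      have h1 : μ[W n • (fun ω => Complex.I * P ω) | G n] =ᵐ[μ] 0 := by
        refine (condExp_smul_of_aestronglyMeasurable_right hWi hprod
          hIPm.aestronglyMeasurable).trans ?_
        filter_upwards [h0 n] with ω hω
        simp [hω]
      refine (condExp_condExp_of_le (G.mono (Nat.zero_le n)) (G.le n)).symm.trans ?_
      refine (condExp_congr_ae h1).trans ?_
      rw [condExp_zero]
    rw [heq]
    filter_upwards [condExp_add hPi hprod (G 0), ih, hz] with ω h1 h2 h3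
    rw [h1, Pi.add_apply, h2, h3]
    simp

/-- A term is kept only while the preceding full sum is at most `n K`, so the overshoot is a single
square, at most `4 n`. -/
theorem sum_sq_stopped_le {y : ℕ → ℝ} {n : ℕ} {K : ℝ} (hK : 0 ≤ K)
    (hy : ∀ i, y i ^ 2 ≤ 4 * ((i : ℝ) + 1)) :
    ∑ i ∈ Finset.range n, (if ∑ j ∈ Finset.range i, y j ^ 2 ≤ n * K then y i else 0) ^ 2
      ≤ n * K + 4 * n := by
  have key : ∀ m ≤ n,
      ∑ i ∈ Finset.range m, (if ∑ j ∈ Finset.range i, y j ^ 2 ≤ n * K then y i else 0) ^ 2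
        ≤ min (∑ j ∈ Finset.range m, y j ^ 2) (n * K + 4 * n) := by
    intro m
    induction m with
    | zero => intro _; simp; positivity
    | succ m ih =>
      intro hm
      obtain ⟨h1, h2⟩ := le_min_iff.1 (ih (by omega))
      have hm' : (m : ℝ) + 1 ≤ n := by exact_mod_cast hm
      have hym := hy m
      rw [Finset.sum_range_succ, Finset.sum_range_succ (fun j => y j ^ 2)]
      split_ifs with h
      · exact le_min (by linarith) (by linarith)
      · exact le_min (by nlinarith [sq_nonneg (y m)]) (by linarith)
  exact (key n le_rfl).trans (min_le_right _ _)

/-- Conditional central limit theorem for a sequence `S` approximated by the partial sums of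
martingale differences `Y i` of size `O(√i)`. -/
theorem ae_tendsto_condExp_exp {G : Filtration ℕ mΩ} {Y S : ℕ → Ω → ℝ} {v : ℝ} (hv : 0 ≤ v)
    (hY : ∀ i, StronglyMeasurable[G (i + 1)] (Y i))
    (hb : ∀ i, ∀ᵐ ω ∂μ, |Y i ω| ≤ 2 * √((i : ℝ) + 1))
    (h0 : ∀ i, μ[Y i | G i] =ᵐ[μ] 0)
    (hsq : ∀ᵐ ω ∂μ, Tendsto (fun n : ℕ => (∑ i ∈ Finset.range n, Y i ω ^ 2) / n) atTop (𝓝 v))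
    (hSm : ∀ n, Measurable (S n))
    (hS : ∀ᵐ ω ∂μ, Tendsto (fun n : ℕ => (∑ i ∈ Finset.range n, Y i ω - S n ω) / √(n : ℝ)) atTop
      (𝓝 0)) (t : ℝ) :
    ∀ᵐ ω ∂μ, Tendsto (fun n : ℕ =>
      (μ[fun ω => Complex.exp (t * ((S n ω / √(n : ℝ) : ℝ) : ℂ) * Complex.I) | G 0]) ω) atTop
      (𝓝 (Complex.exp ((-(t ^ 2 * v / 2) : ℝ) : ℂ))) := by
  -- Any level strictly above `v` would do: the stopping is then a.e. inactive for large `n`.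
  set K : ℝ := v + 1 with hK
  have hb' := ae_all_iff.2 hb
  have hysq : ∀ᵐ ω ∂μ, ∀ i, Y i ω ^ 2 ≤ 4 * ((i : ℝ) + 1) := by
    filter_upwards [hb'] with ω hω i
    have h1 : Y i ω ^ 2 ≤ (2 * √((i : ℝ) + 1)) ^ 2 :=
      sq_le_sq' (neg_le_of_abs_le (hω i)) (le_of_abs_le (hω i))
    rw [mul_pow, Real.sq_sqrt (by positivity)] at h1
    linarith
  set W : ℕ → ℕ → Ω → ℝ := fun n i ω =>
    if ∑ j ∈ Finset.range i, Y j ω ^ 2 ≤ n * K then t * Y i ω / √(n : ℝ) else 0 with hW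
  -- Only indices `j < i` enter, so the stopping rule is predictable and `W n i` remains a
  -- martingale difference.
  have hset n i : MeasurableSet[G i] {ω | ∑ j ∈ Finset.range i, Y j ω ^ 2 ≤ n * K} := by
    refine measurableSet_le (Finset.measurable_sum _ fun j hj => ?_) measurable_const
    exact (((hY j).mono (G.mono (Nat.succ_le_of_lt (Finset.mem_range.1 hj)))).measurable).pow_const 2
  have hYi i : Integrable (Y i) μ :=
    Integrable.of_bound ((hY i).mono (G.le _)).aestronglyMeasurable _ (hb i)
  have hWind n i : W n i = {ω | ∑ j ∈ Finset.range i, Y j ω ^ 2 ≤ n * K}.indicator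
      ((t / √(n : ℝ)) • Y i) := by
    ext ω
    simp only [hW, Set.indicator, Set.mem_ofPred_eq, Pi.smul_apply, smul_eq_mul]
    congr 1
    ring
  have hWm n i : StronglyMeasurable[G (i + 1)] (W n i) := by
    rw [hWind]
    exact ((hY i).const_smul _).indicator (G.mono (Nat.le_succ i) _ (hset n i))
  have hWb n i : ∀ᵐ ω ∂μ, |W n i ω| ≤ |t / √(n : ℝ)| * (2 * √((i : ℝ) + 1)) := by
    filter_upwards [hb i] with ω hω
    rw [hWind]
    refine (norm_indicator_le_norm_self (E := ℝ) _ ω).trans ?_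
    rw [Pi.smul_apply, norm_smul, Real.norm_eq_abs, Real.norm_eq_abs]
    gcongr
  have hW0 n i : μ[W n i | G i] =ᵐ[μ] 0 := by
    rw [hWind]
    refine (condExp_indicator ((hYi i).smul _) (hset n i)).trans ?_
    filter_upwards [condExp_smul (μ := μ) (t / √(n : ℝ)) (Y i) (G i), h0 i] with ω h1 h2
    simp [Set.indicator, h1, h2]
  set P : ℕ → Ω → ℂ := fun n ω => ∏ i ∈ Finset.range n, (1 + Complex.I * (W n i ω : ℂ)) with hP
  have hPc n : μ[P n | G 0] =ᵐ[μ] 1 := condExp_prod_one_add_I_mul (hWm n) (hWb n) (hW0 n) n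
  have hPm n : AEStronglyMeasurable (P n) μ := (stronglyMeasurable_prod_one_add_I_mul
    fun i _ => (hWm n i).mono (G.le _)).aestronglyMeasurable
  have hPb n : ∀ᵐ ω ∂μ, ‖P n ω‖ ≤ Real.exp (t ^ 2 * (K + 4)) := by
    filter_upwards [hysq] with ω hω
    refine (norm_prod_one_add_I_mul_le _ _).trans (Real.exp_le_exp.2 ?_)
    have h1 := sum_sq_stopped_le (n := n) (K := K) (by positivity) hω
    have h2 : ∑ i ∈ Finset.range n, W n i ω ^ 2 = t ^ 2 / n * ∑ i ∈ Finset.range n,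
        (if ∑ j ∈ Finset.range i, Y j ω ^ 2 ≤ n * K then Y i ω else 0) ^ 2 := by
      rw [Finset.mul_sum]
      refine Finset.sum_congr rfl fun i _ => ?_
      simp only [hW]
      split_ifs
      · rw [div_pow, mul_pow, Real.sq_sqrt (Nat.cast_nonneg n)]; ring
      · simp
    rw [h2]
    rcases n.eq_zero_or_pos with rfl | hn
    · simp; positivity
    · have hn' : (0 : ℝ) < n := by exact_mod_cast hn
      calc _ ≤ t ^ 2 / n * (n * K + 4 * n) := by gcongr
        _ = _ := by field_simp
  have hPi n : Integrable (P n) μ := Integrable.of_bound (hPm n) _ (hPb n)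
  set c : ℂ := Complex.exp ((t ^ 2 * v / 2 : ℝ) : ℂ) with hc
  set E : ℕ → Ω → ℂ := fun n ω =>
    Complex.exp (t * ((S n ω / √(n : ℝ) : ℝ) : ℂ) * Complex.I) with hE
  have hE1 n ω : ‖E n ω‖ = 1 := by
    rw [hE]
    simp only
    rw [← Complex.ofReal_mul, Complex.norm_exp_ofReal_mul_I]
  have hEm n : AEStronglyMeasurable (E n) μ := by
    refine Measurable.aestronglyMeasurable ?_
    have := hSm n
    fun_prop
  have hEi n : Integrable (E n) μ := Integrable.of_bound (hEm n) 1 (ae_of_all _ fun ω => (hE1 n ω).le)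
  have hlim : ∀ᵐ ω ∂μ, Tendsto (fun n => (c • E n - P n) ω) atTop (𝓝 0) := by
    filter_upwards [hsq, hS] with ω hω1 hω2
    have hQ := tendsto_prod_one_add_I_mul t hω1
    have hr : Tendsto (fun n : ℕ => Complex.exp (Complex.I *
        ((t * ((∑ i ∈ Finset.range n, Y i ω - S n ω) / √(n : ℝ)) : ℝ) : ℂ))) atTop (𝓝 1) := by
      have h1 : Continuous fun x : ℝ => Complex.exp (Complex.I * ((t * x : ℝ) : ℂ)) := by fun_prop
      have h2 := (h1.tendsto 0).comp hω2
      simp only [mul_zero, Complex.ofReal_zero, Complex.exp_zero] at h2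
      exact h2
    have hlim0 := (tendsto_const_nhds (x := c)).sub (hQ.mul hr)
    rw [mul_one, sub_self] at hlim0
    refine squeeze_zero_norm' ?_ (tendsto_zero_iff_norm_tendsto_zero.1 hlim0)
    filter_upwards [hω1.eventually_lt_const (lt_add_one v), eventually_gt_atTop 0] with n hn hn0
    have hn' : (0 : ℝ) < n := by exact_mod_cast hn0
    rw [div_lt_iff₀ hn'] at hn
    have hWY : ∀ i ∈ Finset.range n, W n i ω = t * Y i ω / √(n : ℝ) := by
      intro i hi
      refine if_pos (le_trans ?_ (hn.le.trans (le_of_eq (mul_comm _ _))))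
      exact Finset.sum_le_sum_of_subset_of_nonneg
        (Finset.range_subset_range.2 (Finset.mem_range.1 hi).le) fun _ _ _ => sq_nonneg _
    have hPn : P n ω = ∏ i ∈ Finset.range n,
        (1 + Complex.I * ((t * Y i ω / √(n : ℝ) : ℝ) : ℂ)) :=
      Finset.prod_congr rfl fun i hi => by rw [hWY i hi]
    refine le_of_eq ?_
    -- Multiplying by the unimodular `E n ω` turns `c - Q r` into `c * E n ω - P n ω`.
    rw [← one_mul ‖c - _‖, ← hE1 n ω, ← norm_mul]
    congr 1
    have hone : E n ω * (Complex.exp (-(Complex.I * ((∑ i ∈ Finset.range n,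
        t * Y i ω / √(n : ℝ) : ℝ) : ℂ))) * Complex.exp (Complex.I *
        ((t * ((∑ i ∈ Finset.range n, Y i ω - S n ω) / √(n : ℝ)) : ℝ) : ℂ))) = 1 := by
      rw [hE, ← Complex.exp_add, ← Complex.exp_add, ← Complex.exp_zero]
      congr 1
      rw [← Finset.sum_div, ← Finset.mul_sum]
      push_cast
      ring
    rw [mul_sub, Pi.sub_apply, Pi.smul_apply, smul_eq_mul, mul_comm c, ← hPn, mul_assoc (P n ω),
      mul_left_comm (E n ω) (P n ω), hone, mul_one]
  have hdiff : ∀ᵐ ω ∂μ, Tendsto (fun n => (μ[c • E n - P n | G 0]) ω) atTop (𝓝 0) := by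
    refine ae_tendsto_condExp_zero (G.le 0) (C := ‖c‖ + Real.exp (t ^ 2 * (K + 4)))
      (fun n => ((hEm n).const_smul c).sub (hPm n)) (fun n => ?_) hlim
    filter_upwards [hPb n] with ω hω
    refine (norm_sub_le _ _).trans (add_le_add ?_ hω)
    rw [Pi.smul_apply, norm_smul, hE1, mul_one]
  have hsplit : ∀ᵐ ω ∂μ, ∀ n, (μ[c • E n - P n | G 0]) ω = c * (μ[E n | G 0]) ω - 1 := by
    refine ae_all_iff.2 fun n => ?_
    filter_upwards [condExp_sub ((hEi n).smul c) (hPi n) (G 0), condExp_smul (μ := μ) c (E n) (G 0),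
      hPc n] with ω h1 h2 h3
    rw [h1, Pi.sub_apply, h2, h3]
    simp
  filter_upwards [hdiff, hsplit] with ω h1 h2
  have hc0 : c ≠ 0 := Complex.exp_ne_zero _
  have h3 := (h1.add_const 1).const_mul c⁻¹
  have h4 : c⁻¹ * (0 + 1) = Complex.exp ((-(t ^ 2 * v / 2) : ℝ) : ℂ) := by
    rw [hc, ← Complex.exp_neg]; simp
  rw [h4] at h3
  refine h3.congr fun n => ?_
  rw [h2, sub_add_cancel, inv_mul_cancel_left₀ hc0]

end Conditional

/-! ### From kernels to conditional characteristic functions. -/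

section Kernel

variable {Ω β : Type*} {mΩ : MeasurableSpace Ω} {μ : Measure Ω} [IsProbabilityMeasure μ]
  {mβ : MeasurableSpace β} {X : Ω → β}

/-- Rational half-lines form a countable generating π-system, so a single null set suffices. -/
theorem ae_eq_condDistrib {η : Kernel β ℝ} [IsMarkovKernel η] (hX : Measurable X) {V : Ω → ℝ}
    (hV : Measurable V) (h : ∀ q : ℚ, (fun ω => (η (X ω)).real (Set.Iic (q : ℝ))) =ᵐ[μ]
      μ⟦V ⁻¹' Set.Iic (q : ℝ) | mβ.comap X⟧) :
    ∀ᵐ ω ∂μ, η (X ω) = condDistrib V X μ (X ω) := by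
  have h' : ∀ᵐ ω ∂μ, ∀ q : ℚ, (η (X ω)).real (Set.Iic (q : ℝ))
      = (condDistrib V X μ (X ω)).real (Set.Iic (q : ℝ)) :=
    ae_all_iff.2 fun q => (h q).trans (condDistrib_ae_eq_condExp hX hV measurableSet_Iic).symm
  filter_upwards [h'] with ω hω
  refine ext_of_generate_finite _ ((BorelSpace.measurable_eq (α := ℝ)).trans
    Real.borel_eq_generateFrom_Iic_rat) Real.isPiSystem_Iic_rat (fun s hs => ?_) (by simp)
  simp only [Set.mem_iUnion, Set.mem_singleton_iff] at hs
  obtain ⟨q, rfl⟩ := hs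
  exact (measureReal_eq_measureReal_iff).1 (hω q)

theorem condExp_exp_ae_eq_charFun {η : Kernel β ℝ} [IsMarkovKernel η] (hX : Measurable X)
    {V : Ω → ℝ} (hV : Measurable V) (h : ∀ q : ℚ, (fun ω => (η (X ω)).real (Set.Iic (q : ℝ))) =ᵐ[μ]
      μ⟦V ⁻¹' Set.Iic (q : ℝ) | mβ.comap X⟧) (t : ℝ) :
    μ[fun ω => Complex.exp (t * (V ω : ℂ) * Complex.I) | mβ.comap X] =ᵐ[μ]
      fun ω => charFun (η (X ω)) t := by
  have hc : Continuous fun x : ℝ => Complex.exp (t * (x : ℂ) * Complex.I) := by fun_prop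
  refine (condExp_ae_eq_integral_condDistrib hX hV.aemeasurable hc.stronglyMeasurable ?_).trans ?_
  · refine Integrable.of_bound (hc.measurable.comp hV).aestronglyMeasurable 1 (ae_of_all _ fun ω => ?_)
    rw [← Complex.ofReal_mul, Complex.norm_exp_ofReal_mul_I]
  · filter_upwards [ae_eq_condDistrib hX hV h] with ω hω
    rw [hω, charFun_apply_real]

theorem ae_distFunTendsto_of_charFun {η : ℕ → Kernel β ℝ} [∀ n, IsMarkovKernel (η n)]
    (hX : Measurable X) {ν₀ : Measure ℝ} [IsProbabilityMeasure ν₀]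
    (h : ∀ t : ℝ, ∀ᵐ ω ∂μ,
      Tendsto (fun n => charFun (η n (X ω)) t) atTop (𝓝 (charFun ν₀ t))) :
    ∀ᵐ ω ∂μ, DistFunTendsto (fun n z => (η n (X ω)).real (Set.Iic z)) (fun z => cdf ν₀ z) := by
  have hm n : Measurable (Function.uncurry fun (t : ℝ) (ω : Ω) => charFun (η n (X ω)) t) := by
    refine measurable_uncurry_of_continuous_of_measurable (fun ω => ?_) fun t => ?_
    · exact continuous_charFun
    · have hc : Continuous fun x : ℝ => Complex.exp (t * (x : ℂ) * Complex.I) := by fun_prop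
      have := (hc.stronglyMeasurable.integral_kernel (κ := η n)).measurable.comp hX
      simp only [charFun_apply_real]
      exact this
  have hm0 : Measurable fun p : ℝ × Ω => charFun ν₀ p.1 :=
    (continuous_charFun (μ := ν₀)).measurable.comp measurable_fst
  have hset := measurableSet_tendsto_fun (l := atTop) hm hm0
  -- Exchanges "for all `t`, a.e. `ω`" for "a.e. `ω`, a.e. `t`"; this needs the joint measurability
  -- above.
  have hae := (Measure.ae_ae_comm (μ := (volume : Measure ℝ)) (ν := μ)
    (p := fun t ω => Tendsto (fun n => charFun (η n (X ω)) t) atTop (𝓝 (charFun ν₀ t)))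
    hset).1 (ae_of_all _ h)
  filter_upwards [hae] with ω hω using distFunTendsto_cdf_of_ae_charFun hω

end Kernel

/-! ### Conditional expectation along a measure-preserving map. -/

section MeasurePreserving

variable {Ω : Type*} {m mΩ : MeasurableSpace Ω} {μ : Measure Ω} [IsProbabilityMeasure μ]

theorem condExp_comp_measurePreserving (hm : m ≤ mΩ) {T : Ω → Ω} (hT : MeasurePreserving T μ μ)
    {g : Ω → ℝ} (hg : Integrable g μ) :
    μ[g ∘ T | m.comap T] =ᵐ[μ] μ[g | m] ∘ T := by
  have hle : m.comap T ≤ mΩ :=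
    (MeasurableSpace.comap_mono hm).trans hT.measurable.comap_le
  have hi : Integrable (μ[g | m] ∘ T) μ := hT.integrable_comp_of_integrable integrable_condExp
  refine (ae_eq_condExp_of_forall_setIntegral_eq hle (hT.integrable_comp_of_integrable hg)
    (fun _ _ _ => hi.integrableOn) ?_ ?_).symm
  · rintro _ ⟨A, hA, rfl⟩ -
    have key : ∀ u : Ω → ℝ, Integrable u μ →
        ∫ ω in T ⁻¹' A, (u ∘ T) ω ∂μ = ∫ ω in A, u ω ∂μ := fun u hu => by
      have := setIntegral_map (μ := μ) (g := T) (f := u) (hm A hA)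
        (by rw [hT.map_eq]; exact hu.aestronglyMeasurable) hT.measurable.aemeasurable
      rw [hT.map_eq] at this
      exact this.symm
    rw [key _ integrable_condExp, key _ hg, setIntegral_condExp hm hg hA]
  · exact (stronglyMeasurable_condExp.comp_measurable
      (comap_measurable T)).aestronglyMeasurable

end MeasurePreserving

/-! ### Truncation and summability of its error. -/

section Truncation

/-- The truncation of `x` at level `a`. -/
noncomputable def smallPart (a x : ℝ) : ℝ := if |x| ≤ a then x else 0

theorem measurable_smallPart (a : ℝ) : Measurable (smallPart a) :=
  Measurable.ite (measurableSet_le measurable_id.abs measurable_const) measurable_id measurable_const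

theorem abs_smallPart_le {a : ℝ} (ha : 0 ≤ a) (x : ℝ) : |smallPart a x| ≤ a := by
  unfold smallPart
  split_ifs with h
  · exact h
  · simpa using ha

theorem abs_sub_smallPart_le (a x : ℝ) : |x - smallPart a x| ≤ |x| := by
  unfold smallPart
  split_ifs
  · simp
  · simp

/-- Only indices with `√(i+1) < |x|` contribute, and `1 / √(i+1) ≤ 2 (√(i+1) - √i)` telescopes. The
minimum in `key` records where contributions cease. -/
theorem sum_abs_sub_smallPart_div_sqrt_le (x : ℝ) (n : ℕ) :
    ∑ i ∈ Finset.range n, |x - smallPart √((i : ℝ) + 1) x| / √((i : ℝ) + 1) ≤ 2 * x ^ 2 := by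
  have key : ∑ i ∈ Finset.range n, |x - smallPart √((i : ℝ) + 1) x| / √((i : ℝ) + 1)
      ≤ 2 * |x| * min √(n : ℝ) |x| := by
    induction n with
    | zero => simp
    | succ n ih =>
      rw [Finset.sum_range_succ]
      have hs : √(n : ℝ) ≤ √((n : ℝ) + 1) := Real.sqrt_le_sqrt (by linarith)
      have hs0 : 0 < √((n : ℝ) + 1) := by positivity
      push_cast
      unfold smallPart at ih ⊢
      split_ifs with h
      · rw [sub_self, abs_zero, zero_div, add_zero]
        refine ih.trans ?_
        gcongr
      · rw [sub_zero]
        rw [not_le] at h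
        rw [min_eq_left (hs.trans h.le)] at ih
        rw [min_eq_left h.le]
        have h1 : |x| / √((n : ℝ) + 1) ≤ 2 * |x| * (√((n : ℝ) + 1) - √(n : ℝ)) := by
          rw [div_le_iff₀ hs0]
          have e1 : √((n : ℝ) + 1) * √((n : ℝ) + 1) = n + 1 := Real.mul_self_sqrt (by positivity)
          have e2 : √(n : ℝ) * √(n : ℝ) = n := Real.mul_self_sqrt (by positivity)
          have e3 : 1 ≤ 2 * (√((n : ℝ) + 1) - √(n : ℝ)) * √((n : ℝ) + 1) := by
            nlinarith [sq_nonneg (√((n : ℝ) + 1) - √(n : ℝ))]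
          nlinarith [abs_nonneg x]
        linarith
  refine key.trans ?_
  rw [← sq_abs x]
  nlinarith [min_le_right √(n : ℝ) |x|, abs_nonneg x]

variable {Ω : Type*} {mΩ : MeasurableSpace Ω} {μ : Measure Ω}

theorem ae_summable_of_summable_integral_norm {u : ℕ → Ω → ℝ} (hi : ∀ n, Integrable (u n) μ)
    (h : Summable fun n => ∫ ω, ‖u n ω‖ ∂μ) : ∀ᵐ ω ∂μ, Summable fun n => ‖u n ω‖ := by
  have h1 : ∫⁻ ω, ∑' n, ‖u n ω‖ₑ ∂μ ≠ ⊤ := by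
    rw [lintegral_tsum fun n => (hi n).aestronglyMeasurable.enorm]
    simp_rw [← ofReal_integral_norm_eq_lintegral_enorm (hi _)]
    exact h.tsum_ofReal_ne_top
  filter_upwards [ae_lt_top' (AEMeasurable.tsum
    fun n => (hi n).aestronglyMeasurable.enorm) h1] with ω hω
  have := ENNReal.summable_toReal hω.ne
  simpa using this

end Truncation

theorem toNNReal_eLpNorm_two_sq {Ω : Type*} {mΩ : MeasurableSpace Ω} {μ : Measure Ω} {f : Ω → ℝ} (hf : MemLp f 2 μ) :
    (((eLpNorm f 2 μ).toNNReal ^ 2 : NNReal) : ℝ) = ∫ ω, f ω ^ 2 ∂μ := by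
  have h0 : 0 ≤ ∫ ω, f ω ^ 2 ∂μ := integral_nonneg fun _ => sq_nonneg _
  rw [hf.eLpNorm_eq_integral_rpow_norm two_ne_zero ENNReal.ofNat_ne_top]
  simp only [ENNReal.toReal_ofNat, Real.norm_eq_abs, Real.rpow_two, sq_abs, NNReal.coe_pow]
  rw [← one_div, ← Real.sqrt_eq_rpow, ENNReal.ofReal, ENNReal.toNNReal_coe, Real.coe_toNNReal _ (Real.sqrt_nonneg _), Real.sq_sqrt h0]

/-! ### Application to the stationary martingale differences. -/

section MartingaleDifference

variable {Ω : Type*} {mΩ : MeasurableSpace Ω} {μ : Measure Ω} [IsProbabilityMeasure μ]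

theorem partialSum_eq_sum_range (T : Ω → Ω) (f : Ω → ℝ) (n : ℕ) (ω : Ω) :
    partialSum T f n ω = ∑ i ∈ Finset.range n, f (T^[i + 1] ω) := by
  unfold partialSum
  induction n with
  | zero => simp
  | succ n ih => rw [Finset.sum_Icc_succ_top (by omega), Finset.sum_range_succ, ih]

theorem filtration_natCast_eq_comap {T : Ω → Ω} {F : Filtration ℤ mΩ}
    (hF : ∀ i : ℤ, F (i + 1) = MeasurableSpace.comap T (F i)) (n : ℕ) :
    F n = MeasurableSpace.comap T^[n] (F 0) := by
  induction n with
  | zero => simp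
  | succ n ih =>
    rw [Nat.cast_succ, hF, ih, MeasurableSpace.comap_comp, Function.iterate_succ]

/-- The restriction of a filtration indexed by `ℤ` to the nonnegative times. -/
def natFiltration (F : Filtration ℤ mΩ) : Filtration ℕ mΩ where
  seq n := F n
  mono' _ _ h := F.mono (by exact_mod_cast h)
  le' n := F.le n

/-- The quenched limit of the conditional characteristic functions of a stationary ergodic
martingale difference sequence. -/
theorem ae_tendsto_condExp_exp_partialSum {T : Ω → Ω} (hT : Ergodic T μ)
    {F : Filtration ℤ mΩ} (hF : ∀ i : ℤ, F (i + 1) = MeasurableSpace.comap T (F i))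
    {f : Ω → ℝ} (hf : f ∈ martingaleDifferenceSpace μ T (F 0)) (t : ℝ) :
    ∀ᵐ ω ∂μ, Tendsto (fun n : ℕ => (μ[fun ω =>
      Complex.exp (t * ((partialSum T f n ω / √(n : ℝ) : ℝ) : ℂ) * Complex.I) | F 0]) ω) atTop
      (𝓝 (Complex.exp ((-(t ^ 2 * (∫ ω, f ω ^ 2 ∂μ) / 2) : ℝ) : ℂ))) := by
  obtain ⟨hfm0, hf2, hf0⟩ := hf
  have hfm : Measurable f := hfm0.mono (F.le 0) le_rfl
  have hfi : Integrable f μ := hf2.integrable one_le_two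
  have hTi (n : ℕ) : MeasurePreserving T^[n] μ μ := hT.toMeasurePreserving.iterate n
  set G := natFiltration F with hG
  set X : ℕ → Ω → ℝ := fun i ω => f (T^[i + 1] ω) with hX
  set a : ℕ → ℝ := fun i => √((i : ℝ) + 1) with ha
  have ha0 i : 0 < a i := by positivity
  have hGc n : G n = MeasurableSpace.comap T^[n] (F 0) := filtration_natCast_eq_comap hF n
  have hXG i : Measurable[G (i + 1)] (X i) := by
    rw [hGc]
    exact hfm0.comp (comap_measurable _)
  have hXi i : Integrable (X i) μ := (hTi (i + 1)).integrable_comp_of_integrable hfi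
  have hX0 i : μ[X i | G i] =ᵐ[μ] 0 := by
    have h1 : X i = (f ∘ T) ∘ T^[i] := by
      ext ω
      simp [hX, Function.iterate_succ_apply']
    rw [hGc, h1]
    refine (condExp_comp_measurePreserving (F.le 0) (hTi i)
      (hT.toMeasurePreserving.integrable_comp_of_integrable hfi)).trans ?_
    exact (hTi i).quasiMeasurePreserving.ae_eq_comp hf0
  set U : ℕ → Ω → ℝ := fun i ω => smallPart (a i) (X i ω) with hU
  have hUG i : Measurable[G (i + 1)] (U i) := (measurable_smallPart _).comp (hXG i)
  have hUb i ω : |U i ω| ≤ a i := abs_smallPart_le (ha0 i).le _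
  have hUi i : Integrable (U i) μ := Integrable.of_bound
    ((hUG i).mono (G.le _) le_rfl).aestronglyMeasurable (a i) (ae_of_all _ (hUb i))
  set R : ℕ → Ω → ℝ := fun i ω => X i ω - U i ω with hR
  have hRi i : Integrable (R i) μ := (hXi i).sub (hUi i)
  -- Truncation destroys the martingale property; recentring restores it and at most doubles the
  -- bound.
  set Y : ℕ → Ω → ℝ := fun i ω => U i ω - (μ[U i | G i]) ω with hY
  have hYm i : StronglyMeasurable[G (i + 1)] (Y i) :=
    (hUG i).stronglyMeasurable.sub (stronglyMeasurable_condExp.mono (G.mono (Nat.le_succ i)))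
  have hYb i : ∀ᵐ ω ∂μ, |Y i ω| ≤ 2 * √((i : ℝ) + 1) := by
    filter_upwards [ae_bdd_abs_condExp_of_ae_bdd_abs (m := G i) (ae_of_all μ (hUb i))] with ω hω
    have h1 : |(μ[U i | G i]) ω| ≤ a i := hω
    calc |Y i ω| ≤ |U i ω| + |(μ[U i | G i]) ω| := abs_sub _ _
      _ ≤ a i + a i := add_le_add (hUb i ω) h1
      _ = _ := by rw [ha]; ring
  have hY0 i : μ[Y i | G i] =ᵐ[μ] 0 := by
    refine (condExp_sub (hUi i) integrable_condExp (G i)).trans ?_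
    rw [condExp_of_stronglyMeasurable (G.le i) stronglyMeasurable_condExp integrable_condExp,
      sub_self]
  have hYX i : ∀ᵐ ω ∂μ, |Y i ω - X i ω| ≤ |R i ω| + |(μ[R i | G i]) ω| := by
    filter_upwards [condExp_sub (hXi i) (hUi i) (G i), hX0 i] with ω h1 h2
    -- As `X i` has zero conditional mean, the recentring term is controlled by the discarded part
    -- `R i`.
    have h3 : (μ[R i | G i]) ω = -(μ[U i | G i]) ω := by
      refine h1.trans ?_
      rw [Pi.sub_apply, h2, Pi.zero_apply, zero_sub]
    have h4 : Y i ω - X i ω = (μ[R i | G i]) ω - R i ω := by rw [h3]; simp only [hY, hR]; ring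
    rw [h4, add_comm]
    exact abs_sub _ _
  have hRint i : ∫ ω, |R i ω| ∂μ = ∫ ω, |f ω - smallPart (a i) (f ω)| ∂μ := by
    have hm : Measurable fun ω => |f ω - smallPart (a i) (f ω)| :=
      (hfm.sub ((measurable_smallPart _).comp hfm)).abs
    have := integral_map (μ := μ) (hTi (i + 1)).measurable.aemeasurable
      (f := fun ω => |f ω - smallPart (a i) (f ω)|) hm.aestronglyMeasurable
    rw [(hTi (i + 1)).map_eq] at this
    exact this.symm
  have hsq_int : Integrable (fun ω => f ω ^ 2) μ := hf2.integrable_sq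
  have hsumR : Summable fun i => (∫ ω, |R i ω| ∂μ) / a i := by
    refine summable_of_sum_range_le (c := ∫ ω, 2 * f ω ^ 2 ∂μ)
      (fun i => div_nonneg (integral_nonneg fun _ => abs_nonneg _) (ha0 i).le) fun n => ?_
    have hi i : Integrable (fun ω => |f ω - smallPart (a i) (f ω)| / a i) μ := by
      refine (hfi.abs.mono' ?_ (ae_of_all _ fun ω => ?_)).div_const _
      · exact ((hfm.sub ((measurable_smallPart _).comp hfm)).abs).aestronglyMeasurable
      · rw [Real.norm_eq_abs, abs_abs]
        exact abs_sub_smallPart_le _ _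
    simp_rw [hRint, ← integral_div]
    rw [← integral_finsetSum _ fun i _ => hi i]
    exact integral_mono (integrable_finsetSum _ fun i _ => hi i) (hsq_int.const_mul 2)
      fun ω => sum_abs_sub_smallPart_div_sqrt_le (f ω) n
  have hsumc : Summable fun i => (∫ ω, |(μ[R i | G i]) ω| ∂μ) / a i :=
    hsumR.of_nonneg_of_le
      (fun i => div_nonneg (integral_nonneg fun _ => abs_nonneg _) (ha0 i).le) fun i =>
      div_le_div_of_nonneg_right (integral_abs_condExp_le _) (ha0 i).le
  have haesum : ∀ u : ℕ → Ω → ℝ, (∀ i, Integrable (u i) μ) →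
      (Summable fun i => (∫ ω, |u i ω| ∂μ) / a i) →
      ∀ᵐ ω ∂μ, Summable fun i => |u i ω| / a i := by
    intro u hu hs
    have := ae_summable_of_summable_integral_norm (μ := μ) (u := fun i ω => u i ω / a i)
      (fun i => (hu i).div_const _) (by
        refine hs.congr fun i => ?_
        simp_rw [norm_div, Real.norm_eq_abs, abs_of_pos (ha0 i)]
        rw [integral_div])
    filter_upwards [this] with ω hω
    simpa only [norm_div, Real.norm_eq_abs, abs_of_pos (ha0 _)] using hω
  have hsmall : ∀ᵐ ω ∂μ, Tendsto
      (fun n : ℕ => (∑ i ∈ Finset.range n, |Y i ω - X i ω|) / √(n : ℝ)) atTop (𝓝 0) := by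
    filter_upwards [ae_all_iff.2 hYX, haesum R hRi hsumR,
      haesum (fun i => μ[R i | G i]) (fun _ => integrable_condExp) hsumc] with ω h1 h2 h3
    refine tendsto_sum_div_sqrt_of_summable (fun i => abs_nonneg _) ?_
    refine (h2.add h3).of_nonneg_of_le (fun i => div_nonneg (abs_nonneg _) (ha0 i).le) fun i => ?_
    rw [← add_div]
    exact div_le_div_of_nonneg_right (h1 i) (ha0 i).le
  have hXsq : ∀ᵐ ω ∂μ, Tendsto (fun n : ℕ => (∑ i ∈ Finset.range n, X i ω ^ 2) / n) atTop
      (𝓝 (∫ ω, f ω ^ 2 ∂μ)) := by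
    have h1 : ∀ᵐ ω ∂μ, Tendsto (fun n : ℕ => birkhoffSum T (fun ω => f ω ^ 2) n ω / n) atTop
      (𝓝 (∫ ω, f ω ^ 2 ∂μ)) := ae_tendsto_birkhoffSum_div hT (hfm.pow_const 2) hsq_int
    -- The sums start at `f ∘ T`, so Birkhoff's theorem is used at `T ω`.
    filter_upwards [hT.toMeasurePreserving.quasiMeasurePreserving.ae h1] with ω hω
    exact hω
  have hYsq : ∀ᵐ ω ∂μ, Tendsto (fun n : ℕ => (∑ i ∈ Finset.range n, Y i ω ^ 2) / n) atTop
      (𝓝 (∫ ω, f ω ^ 2 ∂μ)) := by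
    filter_upwards [hXsq, hsmall] with ω h1 h2 using tendsto_sum_sq_div_of_sum_abs_sub h1 h2
  have hSm n : Measurable (partialSum T f n) :=
    Finset.measurable_sum _ fun i _ => hfm.comp (hTi i).measurable
  have hS : ∀ᵐ ω ∂μ, Tendsto (fun n : ℕ =>
      (∑ i ∈ Finset.range n, Y i ω - partialSum T f n ω) / √(n : ℝ)) atTop (𝓝 0) := by
    filter_upwards [hsmall] with ω hω
    refine squeeze_zero_norm (fun n => ?_) hω
    rw [partialSum_eq_sum_range, ← Finset.sum_sub_distrib, norm_div,
      Real.norm_of_nonneg (Real.sqrt_nonneg _)]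
    gcongr
    exact norm_sum_le _ _
  exact ae_tendsto_condExp_exp (integral_nonneg fun _ => sq_nonneg _) hYm hYb hY0 hYsq hSm hS t

theorem measurable_futureSigma (T : Ω → Ω) (f : Ω → ℝ) {i : ℕ} (hi : 1 ≤ i) :
    Measurable[futureSigma T f] fun ω => f (T^[i] ω) :=
  (comap_measurable _).mono (le_iSup (fun i : {i : ℕ // 1 ≤ i} =>
    MeasurableSpace.comap (fun ω => f (T^[i] ω)) inferInstance) ⟨i, hi⟩) le_rfl

theorem measurable_partialSum_div (T : Ω → Ω) (f : Ω → ℝ) (n : ℕ) :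
    Measurable[futureSigma T f] fun ω => partialSum T f n ω / √(n : ℝ) :=
  (Finset.measurable_sum _ fun _ hi =>
    measurable_futureSigma T f (Finset.mem_Icc.1 hi).1).div_const _

theorem futureSigma_le {T : Ω → Ω} {f : Ω → ℝ} (hT : Measurable T) (hf : Measurable f) :
    futureSigma T f ≤ mΩ :=
  iSup_le fun _ => (hf.comp (hT.iterate _)).comap_le

end MartingaleDifference

end QuenchedCLT

/-! ### Conclusion. -/

theorem mainTheorem4 {Ω : Type*} [mΩ : MeasurableSpace Ω] (μ : Measure Ω) [IsProbabilityMeasure μ]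
    (T : Ω ≃ᵐ Ω) (hT : Ergodic T μ)
    (F : Filtration ℤ mΩ) (hF : ∀ i : ℤ, F (i + 1) = MeasurableSpace.comap T (F i))
    (f : Ω → ℝ) (hf : f ∈ QuenchedCLT.martingaleDifferenceSpace μ T (F 0))
    (κ : Kernel[F 0, QuenchedCLT.futureSigma T f] Ω Ω)
    (hκ : QuenchedCLT.IsRegularCondProb μ (F 0) (QuenchedCLT.futureSigma T f) κ) :
    ∀ᵐ ω ∂μ, QuenchedCLT.DistFunTendsto
      (fun n z => QuenchedCLT.condDistFun T f κ n ω z)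
      (fun z => cdf (gaussianReal 0 ((eLpNorm f 2 μ).toNNReal ^ 2)) z) := by
  have hfm : Measurable f := hf.1.mono (F.le 0) le_rfl
  have hVm (n : ℕ) := QuenchedCLT.measurable_partialSum_div T f n
  have hle := QuenchedCLT.futureSigma_le T.measurable hfm
  -- Conditioning on `F 0` is conditioning on the identity viewed as a map into `(Ω, F 0)`, which
  -- brings `κ` into the `condDistrib` setting.
  have hX : Measurable[mΩ, F 0] (id : Ω → Ω) := measurable_id'' (F.le 0)
  let η : ℕ → Kernel[F 0, _] Ω ℝ := fun n =>
    κ.map fun ω => QuenchedCLT.partialSum T f n ω / √(n : ℝ)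
  have hηapp : ∀ n ω (s : Set ℝ), MeasurableSet s → (η n ω).real s
      = (κ ω).real ((fun ω => QuenchedCLT.partialSum T f n ω / √(n : ℝ)) ⁻¹' s) := by
    intro n ω s hs
    rw [measureReal_def, measureReal_def, Kernel.map_apply' _ (hVm n) _ hs]
  have hκM : IsMarkovKernel κ := ⟨hκ.isProbabilityMeasure⟩
  have hηM : ∀ n, IsMarkovKernel (η n) := fun n => Kernel.IsMarkovKernel.map κ (hVm n)
  have hcond : ∀ n, ∀ q : ℚ, (fun ω => (η n (id ω)).real (Set.Iic (q : ℝ))) =ᵐ[μ]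
      μ⟦(fun ω => QuenchedCLT.partialSum T f n ω / √(n : ℝ)) ⁻¹' Set.Iic (q : ℝ)
        | (F 0).comap id⟧ := by
    intro n q
    rw [MeasurableSpace.comap_id]
    simp only [hηapp n _ _ measurableSet_Iic, id]
    exact hκ.ae_eq_condProb _ (hVm n measurableSet_Iic)
  have hchar : ∀ t : ℝ, ∀ᵐ ω ∂μ, Tendsto (fun n => charFun (η n (id ω)) t) atTop
      (𝓝 (charFun (gaussianReal 0 ((eLpNorm f 2 μ).toNNReal ^ 2)) t)) := by
    intro t
    have h1 := fun n => QuenchedCLT.condExp_exp_ae_eq_charFun (η := η n) hX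
      ((hVm n).mono hle le_rfl) (hcond n) t
    filter_upwards [QuenchedCLT.ae_tendsto_condExp_exp_partialSum hT hF hf t,
      ae_all_iff.2 h1] with ω h2 h3
    rw [MeasurableSpace.comap_id] at h3
    have h4 : charFun (gaussianReal 0 ((eLpNorm f 2 μ).toNNReal ^ 2)) t
        = Complex.exp ((-(t ^ 2 * (∫ ω, f ω ^ 2 ∂μ) / 2) : ℝ) : ℂ) := by
      rw [charFun_gaussianReal, ← QuenchedCLT.toNNReal_eLpNorm_two_sq hf.2.1]
      congr 1
      push_cast
      ring
    rw [h4]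
    exact h2.congr h3
  filter_upwards [QuenchedCLT.ae_distFunTendsto_of_charFun hX hchar] with ω hω z hz
  refine (hω z hz).congr fun n => ?_
  exact hηapp n ω _ measurableSet_Iic
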